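/- Let $N,d\ge 1$, let $\Omega\subseteq\mathbb R^N$ be a bounded open set, and let $f:\Omega\times\mathbb R^d\times\mathbb R^{Nd}\to\mathbb R$ be a normal integrand, i.e. $f$ is measurable with respect to $\mathcal L^N\otimes\mathcal B_d\otimes\mathcal B_{Nd}$ (Lebesgue measurable sets in $\Omega$, Borel sets in $\mathbb R^d$ and $\mathbb R^{Nd}$) and, for a.e. $x\in\Omega$, the function $f(x,\cdot,\cdot)$ is lower semicontinuous. Assume: (H1) for a.e. $x\in\Omega$ and every $u\in\mathbb R^d$, the function $f(x,u,\cdot)$ is level convex, i.e. $\{\xi\in\mathbb R^{Nd}: f(x,u,\xi)\le t\}$ is convex for every $t\in\mathbb R$; (H2) there exist $\alpha,\gamma>0$ such that, for a.e. $x\in\Omega$, $f(x,u,\xi)\ge\alpha|\xi|^{\gamma}$ for every $(u,\xi)\in\mathbb R^d\times\mathbb R^{Nd}$. Let $X$ be either $L^\infty(\Omega,\mathbb R^d)$ or the space $C(\Omega,\mathbb R^d)$ of bounded continuous functions from $\Omega$ to $\mathbb R^d$, endowed with the norm $\|\cdot\|_\infty$. For real $p\ge 1$ define $F_p:X\to[0,+\infty]$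 by $F_p(u)=\|f(\cdot,u(\cdot),Du(\cdot))\|_{L^p(\Omega)}$ if $u\in W^{1,p}(\Omega,\mathbb R^d)$ and $F_p(u)=+\infty$ otherwise, and define $F:X\to[0,+\infty]$ by $F(u)=\operatorname{ess\,sup}_{x\in\Omega} f(x,u(x),Du(x))$ if $u\in W^{1,\infty}(\Omega,\mathbb R^d)$ and $F(u)=+\infty$ otherwise, where $Du$ denotes the weak gradient. Then $(F_p)$ $\Gamma$-converges to $F$ in $X$ as $p\to+\infty$, with respect to uniform convergence (the norm $\|\cdot\|_\infty$). That is, for every sequence $(p_n)\subset[1,\infty)$ with $p_n\to+\infty$ and every $u\in X$: (i) $F(u)\le\liminf_{n\to\infty}F_{p_n}(u_n)$ for every sequence $(u_n)\subset X$ with $u_n\to u$ in $X$; (ii) there is a sequence $(u_n)\subset X$ with $u_n\to u$ in $X$ and $\lim_{n\to\infty}F_{p_n}(u_n)=F(u)$. -/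

import Mathlib

open MeasureTheory Filter Topology Set
open scoped ENNReal ContDiff BoundedContinuousFunction

-- A subset `Ω` of `ℝ^N`, as a type, carries the restriction of the Lebesgue measure.
attribute [local instance] MeasureTheory.Measure.Subtype.measureSpace

/-- The space `ℝ^{Nd}` of gradients, with its Euclidean norm; the entry with index `(i, j)`
stands for the partial derivative `∂u_i/∂x_j`. -/
abbrev GradSpace (N d : ℕ) : Type := EuclideanSpace ℝ (Fin d × Fin N)

section Functionals

variable {N d : ℕ} {Ω : Set (EuclideanSpace ℝ (Fin N))}

/-- Normal integrands on `Ω × ℝ^d × ℝ^{Nd}`. The sigma-algebra of `NullMeasurableSpace Ω volume`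
consists of the Lebesgue measurable subsets of `Ω`. -/
structure IsNormalIntegrand
    (f : Ω → EuclideanSpace ℝ (Fin d) → GradSpace N d → ℝ) : Prop where
  /-- joint measurability for (Lebesgue) ⊗ (Borel) ⊗ (Borel) -/
  measurable : Measurable
    (fun z : NullMeasurableSpace Ω (volume : Measure Ω) ×
      EuclideanSpace ℝ (Fin d) × GradSpace N d => f z.1 z.2.1 z.2.2)
  lowerSemicontinuous : ∀ᵐ x : Ω, LowerSemicontinuous
    (fun q : EuclideanSpace ℝ (Fin d) × GradSpace N d => f x q.1 q.2)

/-- Level convexity in the gradient variable: for a.e. `x` and every `u`, all sublevel sets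
`{ξ | f x u ξ ≤ t}` are convex. (Mathlib calls this `QuasiconvexOn`; it is not Morrey's
quasiconvexity.) -/
def IsLevelConvexInGradient
    (f : Ω → EuclideanSpace ℝ (Fin d) → GradSpace N d → ℝ) : Prop :=
  ∀ᵐ x : Ω, ∀ u, QuasiconvexOn ℝ univ (f x u)

/-- The growth condition from below `f(x,u,ξ) ≥ α |ξ|^γ` with some `α, γ > 0`. -/
def HasLowerGrowth
    (f : Ω → EuclideanSpace ℝ (Fin d) → GradSpace N d → ℝ) : Prop :=
  ∃ α γ : ℝ, 0 < α ∧ 0 < γ ∧ ∀ᵐ x : Ω, ∀ u ξ, α * ‖ξ‖ ^ γ ≤ f x u ξ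

/-- `v` is a weak (distributional) gradient of `u` in the open set `Ω`. -/
structure IsWeakGradient (u : Ω → EuclideanSpace ℝ (Fin d)) (v : Ω → GradSpace N d) : Prop where
  locallyIntegrable : LocallyIntegrable u volume
  locallyIntegrable_grad : LocallyIntegrable v volume
  /-- integration by parts against all `φ ∈ C_c^∞(Ω)` -/
  integral_eq : ∀ φ : EuclideanSpace ℝ (Fin N) → ℝ,
    ContDiff ℝ ∞ φ → HasCompactSupport φ → tsupport φ ⊆ Ω →
    ∀ (i : Fin d) (j : Fin N),
      ∫ x : Ω, u x i * fderiv ℝ φ x (EuclideanSpace.single j 1) = -∫ x : Ω, v x (i, j) * φ x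

/-- The Sobolev space `W^{1,p}(Ω, ℝ^d)`, for `1 ≤ p ≤ ∞`. -/
def MemSobolev (p : ℝ≥0∞) (u : Ω → EuclideanSpace ℝ (Fin d)) : Prop :=
  MemLp u p volume ∧ ∃ v : Ω → GradSpace N d, IsWeakGradient u v ∧ MemLp v p volume

open Classical in
/-- The weak gradient `Du` (unique up to a null set), with value `0` if `u` has none. -/
noncomputable def weakGradient (u : Ω → EuclideanSpace ℝ (Fin d)) : Ω → GradSpace N d :=
  if h : ∃ v, IsWeakGradient u v then h.choose else 0

open Classical in
/-- `F_p(u) = ‖f(·,u,Du)‖_p` if `u ∈ W^{1,p}(Ω, ℝ^d)`, and `+∞` otherwise. -/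
noncomputable def powerFunctional
    (f : Ω → EuclideanSpace ℝ (Fin d) → GradSpace N d → ℝ) (p : ℝ)
    (u : Ω → EuclideanSpace ℝ (Fin d)) : ℝ≥0∞ :=
  if MemSobolev (ENNReal.ofReal p) u then
    eLpNorm (fun x => f x (u x) (weakGradient u x)) (ENNReal.ofReal p) volume
  else ⊤

open Classical in
/-- `F(u) = ess sup_Ω f(x,u(x),Du(x))` if `u ∈ W^{1,∞}(Ω, ℝ^d)`, and `+∞` otherwise.
(It is used for `f` that are nonnegative for a.e. `x`, so nothing is cut off by `ofReal`.) -/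
noncomputable def supremalFunctional
    (f : Ω → EuclideanSpace ℝ (Fin d) → GradSpace N d → ℝ)
    (u : Ω → EuclideanSpace ℝ (Fin d)) : ℝ≥0∞ :=
  if MemSobolev ∞ u then
    essSup (fun x => ENNReal.ofReal (f x (u x) (weakGradient u x))) volume
  else ⊤

end Functionals

/-- Gamma-convergence of a sequence of functionals on a metric space. -/
def GammaConverges {X : Type*} [MetricSpace X] (Φ : ℕ → X → ℝ≥0∞) (Ψ : X → ℝ≥0∞) : Prop :=
  (∀ (x : X) (y : ℕ → X), Tendsto y atTop (𝓝 x) →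
      Ψ x ≤ liminf (fun n => Φ n (y n)) atTop) ∧
  (∀ x : X, ∃ y : ℕ → X, Tendsto y atTop (𝓝 x) ∧
      Tendsto (fun n => Φ n (y n)) atTop (𝓝 (Ψ x)))

/-- Gamma-convergence, as `p → ∞`, of a family of functionals indexed by `p ∈ [1,∞)`:
Gamma-convergence along every sequence of exponents diverging to `∞`. -/
def GammaConvergesAtTop {X : Type*} [MetricSpace X] (Φ : ℝ → X → ℝ≥0∞) (Ψ : X → ℝ≥0∞) : Prop :=
  ∀ p : ℕ → ℝ, (∀ n, 1 ≤ p n) → Tendsto p atTop atTop → GammaConverges (fun n => Φ (p n)) Ψ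

/-! The lower bound carries the content. If the liminf is below `r`, pick `s < t < r` and a
subsequence with energies below `s`. Chebyshev at exponent `p_k ≥ k` and Borel–Cantelli give `f(x,
u_k, Du_k) ≤ t` for all large `k`, at a.e. `x` (`ae_eventually_le_of_eLpNorm_le`). The growth
condition bounds `Du_k` in `L²`, so convex combinations of tails of the gradients converge strongly
in `L²`, and a.e. along a subsequence, to a field `m`, which is the weak gradient of the limit `u₀`
(`isWeakGradient_of_tendsto_convexHull_tail`).

At a fixed `x`, lower semicontinuity and compactness force `Du_k(x)` towards the convex set `{ξ |
f(x, u₀(x), ξ) ≤ t}`; its thickenings are convex, so `m(x)` lies in it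
(`LowerSemicontinuous.le_of_tendsto_convexHull_tail`). Growth then makes `m` bounded. For the upper
bound constant sequences suffice, as `‖g‖_p ≤ |Ω|^{1/p} ‖g‖_∞`. -/

/-! ### Convex combinations of tails -/

/-- In a Hilbert space, convex combinations of the tails of a bounded sequence can be chosen
so as to converge in norm. -/
theorem exists_tendsto_mem_convexHull_tail {H : Type*} [NormedAddCommGroup H]
    [InnerProductSpace ℝ H] [CompleteSpace H] (x : ℕ → H) (C : ℝ) (hx : ∀ n, ‖x n‖ ≤ C) :
    ∃ (w : ℕ → H) (m : H), (∀ n, w n ∈ convexHull ℝ (x '' Ici n)) ∧ Tendsto w atTop (𝓝 m) := by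
  set K : ℕ → Set H := fun n => convexHull ℝ (x '' Ici n)
  set δ : ℕ → ℝ := fun n => Metric.infDist 0 (K n)
  have hne : ∀ n, (K n).Nonempty := fun n =>
    ⟨x n, subset_convexHull ℝ _ ⟨n, mem_Ici.2 le_rfl, rfl⟩⟩
  have hanti : Antitone K := fun n m h => convexHull_mono (image_mono (Ici_subset_Ici.2 h))
  have hmono : Monotone δ := fun n m h => Metric.infDist_le_infDist_of_subset (hanti h) (hne m)
  have hle : ∀ n, ∀ y ∈ K n, δ n ≤ ‖y‖ := fun n y hy => by
    simpa using Metric.infDist_le_dist_of_mem (x := (0 : H)) hy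
  have hbdd : BddAbove (range δ) := by
    refine ⟨C, ?_⟩
    rintro _ ⟨n, rfl⟩
    exact (hle n (x n) (subset_convexHull ℝ _ ⟨n, mem_Ici.2 le_rfl, rfl⟩)).trans (hx n)
  set D := ⨆ n, δ n
  have hD : Tendsto δ atTop (𝓝 D) := tendsto_atTop_ciSup hmono hbdd
  have hw : ∀ n : ℕ, ∃ y ∈ K n, ‖y‖ < δ n + 1 / ((n : ℝ) + 1) := fun n => by
    have h : Metric.infDist 0 (K n) < δ n + 1 / ((n : ℝ) + 1) := by
      have : (0 : ℝ) < 1 / ((n : ℝ) + 1) := by positivity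
      change δ n < _
      linarith
    obtain ⟨y, hy, hlt⟩ := (Metric.infDist_lt_iff (hne n)).1 h
    exact ⟨y, hy, by simpa using hlt⟩
  choose w hwK hwlt using hw
  -- For `m ≥ n` the midpoint of `w n` and `w m` lies in `K n`, so has norm at least `δ n`; the
  -- parallelogram law then bounds `‖w n - w m‖` by this root.
  have hb : Tendsto (fun n : ℕ => √(4 * (D + 1 / ((n : ℝ) + 1)) ^ 2 - 4 * δ n ^ 2))
      atTop (𝓝 0) := by
    have h1 := (((tendsto_one_div_add_atTop_nhds_zero_nat (𝕜 := ℝ)).const_add D).pow 2).const_mul 4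
    have h2 := (hD.pow 2).const_mul 4
    simpa using (h1.sub h2).sqrt
  have hcau : CauchySeq w := by
    refine cauchySeq_of_le_tendsto_0' _ (fun n m hnm => ?_) hb
    rw [dist_eq_norm]
    refine Real.le_sqrt_of_sq_le ?_
    have hmid : (1 / 2 : ℝ) • w n + (1 / 2 : ℝ) • w m ∈ K n :=
      convex_convexHull ℝ _ (hwK n) (hanti hnm (hwK m)) (by norm_num) (by norm_num) (by norm_num)
    have h1 := hle n _ hmid
    rw [← smul_add, norm_smul] at h1
    norm_num at h1
    have hpar := parallelogram_law_with_norm ℝ (w n) (w m)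
    have hδ0 : 0 ≤ δ n := Metric.infDist_nonneg
    have hnm' : (1 : ℝ) / ((m : ℝ) + 1) ≤ 1 / ((n : ℝ) + 1) :=
      one_div_le_one_div_of_le (by positivity) (by exact_mod_cast Nat.succ_le_succ hnm)
    have hn1 : ‖w n‖ ≤ D + 1 / ((n : ℝ) + 1) := (hwlt n).le.trans (by
      have := le_ciSup hbdd n
      change δ n ≤ D at this
      linarith)
    have hm1 : ‖w m‖ ≤ D + 1 / ((n : ℝ) + 1) := (hwlt m).le.trans (by
      have := le_ciSup hbdd m
      change δ m ≤ D at this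
      linarith)
    have hn2 := pow_le_pow_left₀ (norm_nonneg _) hn1 2
    have hm2 := pow_le_pow_left₀ (norm_nonneg _) hm1 2
    have h2 : (2 * δ n) ^ 2 ≤ ‖w n + w m‖ ^ 2 :=
      pow_le_pow_left₀ (by positivity) (by linarith) 2
    nlinarith
  obtain ⟨m, hm⟩ := cauchySeq_tendsto_of_complete hcau
  exact ⟨w, m, hwK, hm⟩

/-- A convex combination of `L^p` functions is a.e. a pointwise convex combination. -/
theorem ae_mem_convexHull_of_mem_convexHull_Lp {α E : Type*} [MeasurableSpace α]
    [NormedAddCommGroup E] [NormedSpace ℝ E] {μ : Measure α} {p : ℝ≥0∞}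
    (V : ℕ → Lp E p μ) (n : ℕ) {w : Lp E p μ} (hw : w ∈ convexHull ℝ (V '' Ici n)) :
    ∀ᵐ x ∂μ, w x ∈ convexHull ℝ ((fun k => V k x) '' Ici n) := by
  refine convexHull_min (t := {w : Lp E p μ |
    ∀ᵐ x ∂μ, w x ∈ convexHull ℝ ((fun k => V k x) '' Ici n)}) ?_ ?_ hw
  · rintro _ ⟨k, hk, rfl⟩
    exact ae_of_all _ fun x => subset_convexHull ℝ _ ⟨k, hk, rfl⟩
  · intro y hy z hz a b ha hb hab
    filter_upwards [hy, hz, Lp.coeFn_add (a • y) (b • z), Lp.coeFn_smul a y, Lp.coeFn_smul b z]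
      with x hyx hzx h1 h2 h3
    rw [h1, Pi.add_apply, h2, h3]
    exact convex_convexHull ℝ _ hyx hzx ha hb hab

/-- Sublevels of a lower semicontinuous function, convex in the second variable, are stable under
limits of tail convex combinations in that variable. -/
theorem LowerSemicontinuous.le_of_tendsto_convexHull_tail {E F : Type*} [TopologicalSpace E]
    [NormedAddCommGroup F] [NormedSpace ℝ F] [ProperSpace F] {g : E × F → ℝ}
    (hg : LowerSemicontinuous g) {t R : ℝ} {a : ℕ → E} {a₀ : E}
    (hconv : Convex ℝ {ξ | g (a₀, ξ) ≤ t}) (ha : Tendsto a atTop (𝓝 a₀)) {b : ℕ → F}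
    (hb : ∀ᶠ k in atTop, ‖b k‖ ≤ R) (hle : ∀ᶠ k in atTop, g (a k, b k) ≤ t)
    {N : ℕ → ℕ} (hN : Tendsto N atTop atTop) {w : ℕ → F} {b₀ : F}
    (hw : ∀ n, w n ∈ convexHull ℝ (b '' Ici (N n))) (hlim : Tendsto w atTop (𝓝 b₀)) :
    g (a₀, b₀) ≤ t := by
  set K : Set F := {ξ | g (a₀, ξ) ≤ t}
  have hclosed : IsClosed K :=
    (hg.isClosed_preimage t).preimage (Continuous.prodMk_right a₀)
  -- The points `b k` satisfy the constraint at `a k`, not at `a₀`, so they need not lie in `K`. But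
  -- a subsequence staying away from `K` would have a cluster point, which joint lower
  -- semicontinuity puts in `K`.
  have hnear : ∀ ε > 0, ∀ᶠ k in atTop, b k ∈ Metric.thickening ε K := by
    intro ε hε
    by_contra hcon
    obtain ⟨φ, hφ, hφP⟩ := extraction_of_frequently_atTop
      (((not_eventually.1 hcon).and_eventually hb).and_eventually hle)
    obtain ⟨ξ, -, ψ, hψ, hξ⟩ := tendsto_subseq_of_bounded (s := Metric.closedBall 0 R)
      Metric.isBounded_closedBall (x := b ∘ φ) (fun n => by simpa using (hφP n).1.2)
    have hmem : (a₀, ξ) ∈ g ⁻¹' Iic t := by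
      refine (hg.isClosed_preimage t).mem_of_tendsto
        ((ha.comp (hφ.comp hψ).tendsto_atTop).prodMk_nhds hξ) (Eventually.of_forall fun n => ?_)
      exact (hφP (ψ n)).2
    have hξK : ξ ∈ Metric.thickening ε K := Metric.self_subset_thickening hε K hmem
    obtain ⟨n, hn⟩ := (hξ.eventually (Metric.isOpen_thickening.mem_nhds hξK)).exists
    exact (hφP (ψ n)).1.1 hn
  have hcl : b₀ ∈ closure K := by
    rw [Metric.closure_eq_iInter_cthickening]
    refine mem_iInter₂.2 fun ε hε => ?_
    obtain ⟨k₀, hk₀⟩ := eventually_atTop.1 (hnear ε hε)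
    refine Metric.isClosed_cthickening.mem_of_tendsto hlim ?_
    filter_upwards [hN.eventually_ge_atTop k₀] with n hn
    refine convexHull_min ?_ (hconv.cthickening ε) (hw n)
    rintro _ ⟨k, hk, rfl⟩
    exact Metric.thickening_subset_cthickening _ _ (hk₀ k (hn.trans hk))
  exact hclosed.closure_subset hcl

/-! ### Uniqueness of weak gradients -/

section WeakGradients

variable {N d : ℕ} {Ω : Set (EuclideanSpace ℝ (Fin N))}

theorem integrable_mul_of_tsupport_subset {g : Ω → ℝ} (hg : LocallyIntegrable g volume)
    {φ : EuclideanSpace ℝ (Fin N) → ℝ} (hφ : Continuous φ) (hc : HasCompactSupport φ)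
    (hs : tsupport φ ⊆ Ω) : Integrable (fun x : Ω => g x * φ x) volume := by
  have hc' : HasCompactSupport (fun x : Ω => φ x) := by
    refine HasCompactSupport.of_support_subset_isCompact (K := Subtype.val ⁻¹' tsupport φ) ?_ ?_
    · exact Topology.IsInducing.subtypeVal.isCompact_preimage_iff (by simpa using hs) |>.2 hc
    · exact fun x hx => subset_tsupport φ hx
  exact hg.integrable_smul_right_of_hasCompactSupport (hφ.comp continuous_subtype_val) hc'

theorem IsWeakGradient.ae_eq (hΩ : IsOpen Ω) {u : Ω → EuclideanSpace ℝ (Fin d)}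
    {v v' : Ω → GradSpace N d} (hv : IsWeakGradient u v) (hv' : IsWeakGradient u v') :
    v =ᵐ[volume] v' := by
  have hemb : MeasurableEmbedding (Subtype.val : Ω → EuclideanSpace ℝ (Fin N)) :=
    MeasurableEmbedding.subtype_coe hΩ.measurableSet
  have hcomp : ∀ i j, LocallyIntegrable (fun x => v x (i, j)) volume ∧
      LocallyIntegrable (fun x => v' x (i, j)) volume := fun i j =>
    ⟨fun x => (EuclideanSpace.proj (𝕜 := ℝ) (i, j)).integrableAtFilter_comp
        (hv.locallyIntegrable_grad x),
      fun x => (EuclideanSpace.proj (𝕜 := ℝ) (i, j)).integrableAtFilter_comp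
        (hv'.locallyIntegrable_grad x)⟩
  have key : ∀ ij : Fin d × Fin N, ∀ᵐ x : Ω, v x ij = v' x ij := by
    rintro ⟨i, j⟩
    set g : Ω → ℝ := fun x => v x (i, j) - v' x (i, j)
    have hg : LocallyIntegrable g volume := (hcomp i j).1.sub (hcomp i j).2
    -- The fundamental lemma of the calculus of variations is applied on the whole space, to the
    -- zero extension and the pushforward measure.
    set G : EuclideanSpace ℝ (Fin N) → ℝ := Function.extend Subtype.val g 0
    have hG : ∀ x : Ω, G x = g x := fun x => Subtype.val_injective.extend_apply _ _ x
    have hae := hΩ.ae_eq_zero_of_integral_contDiff_smul_eq_zero (f := G)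
      (μ := Measure.map Subtype.val (volume : Measure Ω)) ?_ ?_
    · rw [hemb.ae_map_iff] at hae
      filter_upwards [hae] with x hx
      have := hx x.2
      rw [hG] at this
      exact sub_eq_zero.1 this
    · rw [locallyIntegrableOn_iff hΩ.isLocallyClosed]
      intro k hk hkc
      rw [hemb.integrableOn_map_iff]
      have : G ∘ Subtype.val = g := funext hG
      rw [this]
      exact hg.integrableOn_isCompact
        (Topology.IsInducing.subtypeVal.isCompact_preimage_iff (by simpa using hk) |>.2 hkc)
    · intro φ hφ hc hs
      rw [hemb.integral_map]
      have h1 := hv.integral_eq φ hφ hc hs i j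
      have h2 := hv'.integral_eq φ hφ hc hs i j
      have h3 := integral_sub
        (integrable_mul_of_tsupport_subset (hcomp i j).1 hφ.continuous hc hs)
        (integrable_mul_of_tsupport_subset (hcomp i j).2 hφ.continuous hc hs)
      calc ∫ x : Ω, φ x • G x = ∫ x : Ω, (v x (i, j) * φ x - v' x (i, j) * φ x) := by
            refine integral_congr_ae (ae_of_all _ fun x => ?_)
            simp only [hG, g, smul_eq_mul]
            ring
        _ = 0 := by rw [h3]; linarith [h1, h2]
  filter_upwards [ae_all_iff.2 key] with x hx
  ext ij
  exact hx ij

end WeakGradients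

/-! ### Passing to the limit in the sublevel constraint -/

section LiminfInequality

variable {N d : ℕ} {Ω : Set (EuclideanSpace ℝ (Fin N))}
  {f : Ω → EuclideanSpace ℝ (Fin d) → GradSpace N d → ℝ}

theorem isFiniteMeasure_volume_subtype (hΩ : IsOpen Ω) (hΩb : Bornology.IsBounded Ω) :
    IsFiniteMeasure (volume : Measure Ω) := by
  refine ⟨?_⟩
  rw [Measure.Subtype.volume_univ hΩ.measurableSet.nullMeasurableSet]
  exact hΩb.measure_lt_top

/-- Since `f` is Borel in its last two variables, `u` and `v` are replaced by Borel representatives.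
In `x` only Lebesgue measurability is available, so the composite is first null measurable. -/
theorem IsNormalIntegrand.aemeasurable_comp (hf : IsNormalIntegrand f)
    {u : Ω → EuclideanSpace ℝ (Fin d)} {v : Ω → GradSpace N d}
    (hu : AEStronglyMeasurable u volume) (hv : AEStronglyMeasurable v volume) :
    AEMeasurable (fun x => f x (u x) (v x)) volume := by
  have hid : Measurable (β := Ω)
      (fun x : NullMeasurableSpace Ω (volume : Measure Ω) => x) :=
    fun s hs => hs.nullMeasurableSet
  have hm : NullMeasurable (fun x => f x (hu.mk u x) (hv.mk v x)) (volume : Measure Ω) := by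
    have := hf.measurable.comp (measurable_id.prodMk
      ((hu.stronglyMeasurable_mk.measurable.comp hid).prodMk
        (hv.stronglyMeasurable_mk.measurable.comp hid)))
    exact fun s hs => this hs
  refine hm.aemeasurable.congr ?_
  filter_upwards [hu.ae_eq_mk, hv.ae_eq_mk] with x h1 h2
  rw [h1, h2]

theorem norm_le_of_growth {α γ t c : ℝ} (hα : 0 < α) (hγ : 0 < γ) (hc : 0 ≤ c)
    (h : α * c ^ γ ≤ t) : c ≤ (t / α) ^ γ⁻¹ := by
  have h1 : c ^ γ ≤ t / α := by rw [le_div_iff₀ hα]; linarith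
  calc c = (c ^ γ) ^ γ⁻¹ := (Real.rpow_rpow_inv hc hγ.ne').symm
    _ ≤ _ := Real.rpow_le_rpow (by positivity) h1 (by positivity)

theorem ae_tendsto_of_tendsto_eLpNorm_top {α E : Type*} [MeasurableSpace α] {μ : Measure α}
    [NormedAddCommGroup E] {u : ℕ → α → E} {u₀ : α → E}
    (h : Tendsto (fun k => eLpNorm (u k - u₀) ∞ μ) atTop (𝓝 0)) :
    ∀ᵐ x ∂μ, Tendsto (fun k => u k x) atTop (𝓝 (u₀ x)) := by
  have h1 : ∀ᵐ x ∂μ, ∀ k, ‖u k x - u₀ x‖ₑ ≤ eLpNorm (u k - u₀) ∞ μ :=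
    ae_all_iff.2 fun k => by
      rw [eLpNorm_exponent_top]
      exact enorm_ae_le_eLpNormEssSup (u k - u₀) μ
  filter_upwards [h1] with x hx
  rw [tendsto_iff_edist_tendsto_0]
  refine tendsto_of_tendsto_of_tendsto_of_le_of_le tendsto_const_nhds h (fun _ => zero_le)
    fun k => ?_
  simpa [edist_eq_enorm_sub] using hx k

/-- Testing against a smooth compactly supported function is continuous for uniform convergence. -/
theorem tendsto_integral_mul_fderiv [IsFiniteMeasure (volume : Measure Ω)]
    {u : ℕ → Ω → EuclideanSpace ℝ (Fin d)} {u₀ : Ω → EuclideanSpace ℝ (Fin d)}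
    (hu : ∀ k, AEStronglyMeasurable (u k) volume) (hu₀ : MemLp u₀ ∞ volume)
    (h : Tendsto (fun k => eLpNorm (u k - u₀) ∞ volume) atTop (𝓝 0))
    {φ : EuclideanSpace ℝ (Fin N) → ℝ} (hφ : ContDiff ℝ ∞ φ) (hc : HasCompactSupport φ)
    (i : Fin d) (j : Fin N) :
    Tendsto (fun k => ∫ x : Ω, u k x i * fderiv ℝ φ x (EuclideanSpace.single j 1)) atTop
      (𝓝 (∫ x : Ω, u₀ x i * fderiv ℝ φ x (EuclideanSpace.single j 1))) := by
  have hD : Continuous fun y => fderiv ℝ φ y (EuclideanSpace.single j 1) :=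
    (hφ.continuous_fderiv (by simp)).clm_apply continuous_const
  obtain ⟨C, hC⟩ := hD.bounded_above_of_compact_support
    (hc.fderiv_apply ℝ (EuclideanSpace.single j 1))
  have hbound := enorm_ae_le_eLpNormEssSup u₀ (volume : Measure Ω)
  have hfin : eLpNormEssSup u₀ (volume : Measure Ω) < ⊤ := by
    simpa [eLpNorm_exponent_top] using hu₀.2
  refine tendsto_integral_filter_of_dominated_convergence
    (fun _ => (1 + (eLpNormEssSup u₀ (volume : Measure Ω)).toReal) * C) ?_ ?_
    (integrable_const _) ?_
  · refine Eventually.of_forall fun k => ?_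
    refine AEStronglyMeasurable.mul ?_ (hD.comp continuous_subtype_val).aestronglyMeasurable
    exact (EuclideanSpace.proj (𝕜 := ℝ) i).continuous.comp_aestronglyMeasurable (hu k)
  · filter_upwards [h.eventually (ge_mem_nhds zero_lt_one)] with k hk
    have h1 : ∀ᵐ x : Ω, ‖(u k - u₀) x‖ₑ ≤ 1 := by
      rw [eLpNorm_exponent_top] at hk
      filter_upwards [enorm_ae_le_eLpNormEssSup (u k - u₀) volume] with x hx using hx.trans hk
    filter_upwards [h1, hbound] with x hx hx'
    rw [norm_mul]
    refine mul_le_mul ?_ (hC _) (norm_nonneg _) (by positivity)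
    have h2 : ‖u k x - u₀ x‖ ≤ 1 := by
      have := ENNReal.toReal_mono ENNReal.one_ne_top hx
      simpa using this
    have h3 : ‖u₀ x‖ ≤ (eLpNormEssSup u₀ (volume : Measure Ω)).toReal := by
      have := ENNReal.toReal_mono hfin.ne hx'
      simpa using this
    calc ‖u k x i‖ ≤ ‖u k x‖ := PiLp.norm_apply_le _ i
      _ = ‖(u k x - u₀ x) + u₀ x‖ := by rw [sub_add_cancel]
      _ ≤ _ := (norm_add_le _ _).trans (add_le_add h2 h3)
  · filter_upwards [ae_tendsto_of_tendsto_eLpNorm_top h] with x hx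
    exact (((EuclideanSpace.proj (𝕜 := ℝ) i).continuous.tendsto _).comp hx).mul_const _

/-- Weak gradients pass to strong `L²` limits of tail convex combinations. -/
theorem isWeakGradient_of_tendsto_convexHull_tail [IsFiniteMeasure (volume : Measure Ω)]
    {u : ℕ → Ω → EuclideanSpace ℝ (Fin d)} {u₀ : Ω → EuclideanSpace ℝ (Fin d)}
    (hu : ∀ k, AEStronglyMeasurable (u k) volume) (hu₀ : MemLp u₀ ∞ volume)
    (h : Tendsto (fun k => eLpNorm (u k - u₀) ∞ volume) atTop (𝓝 0))
    {V : ℕ → Lp (GradSpace N d) 2 (volume : Measure Ω)} (hV : ∀ k, IsWeakGradient (u k) (V k))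
    {w : ℕ → Lp (GradSpace N d) 2 (volume : Measure Ω)}
    {m : Lp (GradSpace N d) 2 (volume : Measure Ω)}
    (hw : ∀ n, w n ∈ convexHull ℝ (V '' Ici n)) (hm : Tendsto w atTop (𝓝 m)) :
    IsWeakGradient u₀ m := by
  refine ⟨(hu₀.integrable le_top).locallyIntegrable,
    ((Lp.memLp m).integrable (by norm_num)).locallyIntegrable, fun φ hφ hc hs i j => ?_⟩
  obtain ⟨C, hC⟩ := hφ.continuous.bounded_above_of_compact_support hc
  -- Testing the entry `(i, j)` against `φ` is the inner product with this field, hence a continuous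
  -- linear functional on `L²`.
  have hg : MemLp (fun x : Ω => φ x • (EuclideanSpace.single (i, j) (1 : ℝ) : GradSpace N d)) 2
      volume := by
    refine MemLp.of_bound ?_ C (ae_of_all _ fun x => ?_)
    · exact ((hφ.continuous.comp continuous_subtype_val).smul
        continuous_const).aestronglyMeasurable
    · rw [norm_smul]
      simpa using hC x
  set G := hg.toLp _
  have hin : ∀ y : Lp (GradSpace N d) 2 (volume : Measure Ω),
      inner ℝ G y = ∫ x : Ω, y x (i, j) * φ x := fun y => by
    rw [L2.inner_def]
    refine integral_congr_ae ?_
    filter_upwards [hg.coeFn_toLp] with x hx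
    rw [hx, inner_smul_left, EuclideanSpace.inner_single_left]
    simp [mul_comm]
  set c := -∫ x : Ω, u₀ x i * fderiv ℝ φ x (EuclideanSpace.single j 1)
  have hVc : Tendsto (fun k => inner ℝ G (V k)) atTop (𝓝 c) := by
    have := (tendsto_integral_mul_fderiv hu hu₀ h hφ hc i j).neg
    refine this.congr fun k => ?_
    rw [hin, (hV k).integral_eq φ hφ hc hs i j, neg_neg]
  have hwc : Tendsto (fun k => inner ℝ G (w k)) atTop (𝓝 c) := by
    rw [Metric.tendsto_atTop] at hVc ⊢
    intro ε hε
    obtain ⟨k₀, hk₀⟩ := hVc ε hε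
    refine ⟨k₀, fun n hn => ?_⟩
    -- Preimages of balls under a linear functional are convex, so convergence along `V` passes to
    -- the tail hulls.
    have hconv : Convex ℝ ((innerSL ℝ G) ⁻¹' Metric.ball c ε) :=
      (convex_ball c ε).linear_preimage (innerSL ℝ G).toLinearMap
    refine convexHull_min ?_ hconv (hw n)
    rintro _ ⟨k, hk, rfl⟩
    exact hk₀ k (hn.trans hk)
  have hmc : inner ℝ G m = c :=
    tendsto_nhds_unique (((innerSL ℝ G).continuous.tendsto m).comp hm) hwc
  rw [← hin, hmc, neg_neg]

/-- If the sublevel constraint `f(x, u_k, Du_k) ≤ t` holds eventually at a.e. point, it passes to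
the uniform limit. -/
theorem exists_isWeakGradient_le_of_ae_eventually_le [IsFiniteMeasure (volume : Measure Ω)]
    (hf : IsNormalIntegrand f) (hf1 : IsLevelConvexInGradient f) (hf2 : HasLowerGrowth f)
    {u : ℕ → Ω → EuclideanSpace ℝ (Fin d)} {u₀ : Ω → EuclideanSpace ℝ (Fin d)}
    (hu : ∀ k, AEStronglyMeasurable (u k) volume) (hu₀ : MemLp u₀ ∞ volume)
    (h : Tendsto (fun k => eLpNorm (u k - u₀) ∞ volume) atTop (𝓝 0))
    {v : ℕ → Ω → GradSpace N d} (hv : ∀ k, IsWeakGradient (u k) (v k))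
    {C : ℝ≥0∞} (hC : C ≠ ⊤) (hvC : ∀ k, eLpNorm (v k) 2 volume ≤ C) {t : ℝ}
    (ht : ∀ᵐ x : Ω, ∀ᶠ k in atTop, f x (u k x) (v k x) ≤ t) :
    ∃ m : Ω → GradSpace N d, IsWeakGradient u₀ m ∧ MemLp m ∞ volume ∧
      ∀ᵐ x : Ω, f x (u₀ x) (m x) ≤ t := by
  have hmem : ∀ k, MemLp (v k) 2 (volume : Measure Ω) := fun k =>
    ⟨(hv k).locallyIntegrable_grad.aestronglyMeasurable, (hvC k).trans_lt hC.lt_top⟩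
  set V : ℕ → Lp (GradSpace N d) 2 (volume : Measure Ω) := fun k => (hmem k).toLp (v k)
  have hVv : ∀ k, V k =ᵐ[volume] v k := fun k => (hmem k).coeFn_toLp
  have hV : ∀ k, IsWeakGradient (u k) (V k) := fun k => by
    refine ⟨(hv k).locallyIntegrable,
      ((Lp.memLp (V k)).integrable (by norm_num)).locallyIntegrable, fun φ hφ hc hs i j => ?_⟩
    rw [(hv k).integral_eq φ hφ hc hs i j]
    congr 1
    refine integral_congr_ae ?_
    filter_upwards [hVv k] with x hx
    rw [hx]
  have hVn : ∀ k, ‖V k‖ ≤ C.toReal := fun k => by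
    rw [Lp.norm_toLp]
    exact ENNReal.toReal_mono hC (hvC k)
  obtain ⟨w, m, hw, hm⟩ := exists_tendsto_mem_convexHull_tail V _ hVn
  have hwg := isWeakGradient_of_tendsto_convexHull_tail hu hu₀ h hV hw hm
  obtain ⟨ns, hns, hae⟩ := (tendstoInMeasure_of_tendsto_Lp hm).exists_seq_tendsto_ae
  obtain ⟨α, γ, hα, hγ, hgrow⟩ := hf2
  have hle : ∀ᵐ x : Ω, f x (u₀ x) (m x) ≤ t := by
    filter_upwards [hf.lowerSemicontinuous, hf1, hgrow, ht, hae,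
      ae_tendsto_of_tendsto_eLpNorm_top h, ae_all_iff.2 hVv,
      ae_all_iff.2 fun n => ae_mem_convexHull_of_mem_convexHull_Lp V n (hw n)]
      with x hlsc hq hg htx hlim hux hVx hwx
    simp only [hVx] at hwx
    refine hlsc.le_of_tendsto_convexHull_tail (R := (t / α) ^ γ⁻¹) ?_ hux ?_ htx
      hns.tendsto_atTop (fun n => hwx (ns n)) hlim
    · simpa using hq (u₀ x) t
    · filter_upwards [htx] with k hk
      exact norm_le_of_growth hα hγ (norm_nonneg _) ((hg _ _).trans hk)
  refine ⟨m, hwg, ?_, hle⟩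
  -- Growth applied to the limit constraint upgrades `m` from `L²` to `L^∞`.
  refine MemLp.of_bound (Lp.aestronglyMeasurable m) ((t / α) ^ γ⁻¹) ?_
  filter_upwards [hle, hgrow] with x hx hg
  exact norm_le_of_growth hα hγ (norm_nonneg _) ((hg _ _).trans hx)

/-- `weakGradient` is an arbitrary choice; a.e. uniqueness transfers to it the bound found for `m`.
-/
theorem supremalFunctional_le_of_isWeakGradient (hΩ : IsOpen Ω)
    {u : Ω → EuclideanSpace ℝ (Fin d)} (hu : MemLp u ∞ volume) {m : Ω → GradSpace N d}
    (hm : IsWeakGradient u m) (hmi : MemLp m ∞ volume) {t : ℝ}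
    (ht : ∀ᵐ x : Ω, f x (u x) (m x) ≤ t) : supremalFunctional f u ≤ ENNReal.ofReal t := by
  have hex : ∃ v, IsWeakGradient u v := ⟨m, hm⟩
  have hgrad : IsWeakGradient u (weakGradient u) := by
    rw [weakGradient, dif_pos hex]
    exact hex.choose_spec
  rw [supremalFunctional, if_pos ⟨hu, m, hm, hmi⟩]
  refine essSup_le_of_ae_le _ ?_
  filter_upwards [ht, hgrad.ae_eq hΩ hm] with x hx hx'
  rw [hx']
  exact ENNReal.ofReal_le_ofReal hx

end LiminfInequality

/-! ### Energy bounds and the Γ-limit -/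

section GammaLimit

variable {N d : ℕ} {Ω : Set (EuclideanSpace ℝ (Fin N))}
  {f : Ω → EuclideanSpace ℝ (Fin d) → GradSpace N d → ℝ}

theorem MemSobolev.isWeakGradient_weakGradient {p : ℝ≥0∞} {u : Ω → EuclideanSpace ℝ (Fin d)}
    (h : MemSobolev p u) : IsWeakGradient u (weakGradient u) := by
  obtain ⟨-, v, hv, -⟩ := h
  have hex : ∃ v, IsWeakGradient u v := ⟨v, hv⟩
  rw [weakGradient, dif_pos hex]
  exact hex.choose_spec

/-- The growth condition turns a bound on the energy into a bound on the `L²` norm of the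
gradient, uniformly in the (large) exponent. -/
theorem eLpNorm_two_le_of_growth [IsFiniteMeasure (volume : Measure Ω)] {α γ : ℝ} (hα : 0 < α)
    (hγ : 0 < γ) (hgrow : ∀ᵐ x : Ω, ∀ u ξ, α * ‖ξ‖ ^ γ ≤ f x u ξ)
    {u : Ω → EuclideanSpace ℝ (Fin d)} {v : Ω → GradSpace N d}
    (hv : AEStronglyMeasurable v volume) {p : ℝ} (hp : 0 ≤ p) (hpγ : 2 ≤ p * γ) {s : ℝ≥0∞}
    (hs : eLpNorm (fun x => f x (u x) (v x)) (ENNReal.ofReal p) volume ≤ s) :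
    eLpNorm v 2 volume ≤
      (‖α⁻¹‖ₑ * s) ^ γ⁻¹ * (1 + (volume : Measure Ω) univ) ^ (1 / 2 : ℝ) := by
  have h1 : eLpNorm v (ENNReal.ofReal p * ENNReal.ofReal γ) volume ^ γ ≤ ‖α⁻¹‖ₑ * s := by
    rw [← eLpNorm_norm_rpow v hγ]
    calc _ ≤ eLpNorm (α⁻¹ • fun x => f x (u x) (v x)) (ENNReal.ofReal p) volume := by
          refine eLpNorm_mono_ae ?_
          filter_upwards [hgrow] with x hx
          have h2 := hx (u x) (v x)
          have h0 : 0 ≤ α * ‖v x‖ ^ γ := by positivity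
          rw [Real.norm_of_nonneg (by positivity), Pi.smul_apply, smul_eq_mul, norm_mul,
            Real.norm_of_nonneg (by positivity), Real.norm_of_nonneg (h0.trans h2),
            inv_mul_eq_div, le_div_iff₀ hα]
          linarith
      _ ≤ _ := by
          rw [eLpNorm_const_smul]
          gcongr
  have h2 : eLpNorm v (ENNReal.ofReal p * ENNReal.ofReal γ) volume ≤ (‖α⁻¹‖ₑ * s) ^ γ⁻¹ := by
    rwa [← ENNReal.rpow_inv_le_iff (inv_pos.2 hγ), inv_inv]
  rw [← ENNReal.ofReal_mul hp] at h2
  have hq : (2 : ℝ≥0∞) ≤ ENNReal.ofReal (p * γ) := by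
    rw [← ENNReal.ofReal_ofNat]
    exact ENNReal.ofReal_le_ofReal hpγ
  refine (eLpNorm_le_eLpNorm_mul_rpow_measure_univ hq hv).trans (mul_le_mul' h2 ?_)
  rw [ENNReal.toReal_ofReal (by linarith), ENNReal.toReal_ofNat]
  -- With base `1 + |Ω| ≥ 1` the Hölder exponent can be raised to `1 / 2`, which no longer depends
  -- on `p`.
  have hle : 1 / (p * γ) ≤ 1 / 2 := one_div_le_one_div_of_le (by norm_num) hpγ
  calc _ ≤ (1 + (volume : Measure Ω) univ) ^ (1 / 2 - 1 / (p * γ)) :=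
        ENNReal.rpow_le_rpow le_add_self (by linarith)
    _ ≤ _ := ENNReal.rpow_le_rpow_of_exponent_le le_self_add
        (by have : 0 ≤ 1 / (p * γ) := by positivity
            linarith)

/-- Along exponents `p_k ≥ k`, a bound `s < t` on the `L^{p_k}` norms of `g_k` forces
`g_k ≤ t` eventually, at almost every point. -/
theorem ae_eventually_le_of_eLpNorm_le {α : Type*} [MeasurableSpace α] {μ : Measure α}
    {g : ℕ → α → ℝ} (hg : ∀ k, AEMeasurable (g k) μ) {p : ℕ → ℝ} (hp : ∀ k, 1 ≤ p k)
    (hpk : ∀ k : ℕ, (k : ℝ) ≤ p k) {s t : ℝ≥0∞} (hst : s < t) (ht : t ≠ ⊤)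
    (hgs : ∀ k, eLpNorm (g k) (ENNReal.ofReal (p k)) μ ≤ s) :
    ∀ᵐ x ∂μ, ∀ᶠ k in atTop, g k x ≤ t.toReal := by
  have ht0 : t ≠ 0 := (zero_le.trans_lt hst).ne'
  have hr : t⁻¹ * s < 1 := by
    rw [mul_comm, ← div_eq_mul_inv]
    exact ENNReal.div_lt_of_lt_mul (by simpa using hst)
  -- Chebyshev gives `(s / t) ^ p k`; since `s / t < 1` and `p k ≥ k`, this is at most a geometric
  -- term.
  have hmeas : ∀ k, μ {x | t ≤ ‖g k x‖ₑ} ≤ (t⁻¹ * s) ^ k := fun k => by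
    have hp0 : 0 < p k := zero_lt_one.trans_le (hp k)
    have h1 := meas_ge_le_mul_pow_eLpNorm_enorm μ (p := ENNReal.ofReal (p k)) (by simpa using hp0)
      ENNReal.ofReal_ne_top (hg k).aestronglyMeasurable ht0 (fun h => absurd h ht)
    rw [ENNReal.toReal_ofReal hp0.le] at h1
    calc _ ≤ t⁻¹ ^ p k * s ^ p k := h1.trans (by gcongr; exact hgs k)
      _ = (t⁻¹ * s) ^ p k := (ENNReal.mul_rpow_of_nonneg _ _ hp0.le).symm
      _ ≤ (t⁻¹ * s) ^ (k : ℝ) := ENNReal.rpow_le_rpow_of_exponent_ge hr.le (hpk k)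
      _ = _ := ENNReal.rpow_natCast _ _
  have hsum : ∑' k, μ {x | t ≤ ‖g k x‖ₑ} ≠ ⊤ := by
    refine ne_top_of_le_ne_top ?_ (ENNReal.tsum_le_tsum hmeas)
    rw [ENNReal.tsum_geometric, Ne, ENNReal.inv_eq_top]
    exact (tsub_pos_of_lt hr).ne'
  filter_upwards [ae_eventually_notMem hsum] with x hx
  filter_upwards [hx] with k hk
  have hk' : ‖g k x‖ₑ < t := not_le.1 hk
  have := (ENNReal.toReal_lt_toReal enorm_ne_top ht).2 hk'
  rw [toReal_enorm] at this
  exact (le_abs_self _).trans this.le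

/-- The lower bound in the Gamma-convergence. -/
theorem supremalFunctional_le_liminf_powerFunctional (hΩ : IsOpen Ω)
    [IsFiniteMeasure (volume : Measure Ω)] (hf : IsNormalIntegrand f)
    (hf1 : IsLevelConvexInGradient f) (hf2 : HasLowerGrowth f)
    {u : ℕ → Ω → EuclideanSpace ℝ (Fin d)} {u₀ : Ω → EuclideanSpace ℝ (Fin d)}
    (hu : ∀ k, AEStronglyMeasurable (u k) volume) (hu₀ : MemLp u₀ ∞ volume)
    (h : Tendsto (fun k => eLpNorm (u k - u₀) ∞ volume) atTop (𝓝 0))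
    {p : ℕ → ℝ} (hp1 : ∀ n, 1 ≤ p n) (hp : Tendsto p atTop atTop) :
    supremalFunctional f u₀ ≤ liminf (fun n => powerFunctional f (p n) (u n)) atTop := by
  obtain ⟨α, γ, hα, hγ, hgrow⟩ := id hf2
  refine le_of_forall_gt_imp_ge_of_dense fun r hr => ?_
  obtain ⟨s, hs, hsr⟩ := exists_between hr
  obtain ⟨t, hst, htr⟩ := exists_between hsr
  have hs_top : s ≠ ⊤ := (hst.trans_le le_top).ne
  have ht_top : t ≠ ⊤ := (htr.trans_le le_top).ne
  have hfreq : ∃ᶠ n in atTop, powerFunctional f (p n) (u n) < s := frequently_lt_of_liminf_lt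
    (by isBoundedDefault) hs
  -- `k ≤ p n` serves Borel–Cantelli, and `2 / γ ≤ p n` the `L²` bound on gradients.
  obtain ⟨ψ, hψ, hψP⟩ := extraction_forall_of_frequently
    (P := fun k n => powerFunctional f (p n) (u n) < s ∧ (k : ℝ) ≤ p n ∧ 2 / γ ≤ p n)
    fun k => hfreq.and_eventually
      ((hp.eventually_ge_atTop (k : ℝ)).and (hp.eventually_ge_atTop (2 / γ)))
  have hsob : ∀ k, MemSobolev (ENNReal.ofReal (p (ψ k))) (u (ψ k)) := fun k => by
    by_contra hcon
    have := (hψP k).1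
    rw [powerFunctional, if_neg hcon] at this
    exact not_top_lt this
  have hen : ∀ k, eLpNorm (fun x => f x (u (ψ k) x) (weakGradient (u (ψ k)) x))
      (ENNReal.ofReal (p (ψ k))) volume ≤ s := fun k => by
    have := (hψP k).1
    rw [powerFunctional, if_pos (hsob k)] at this
    exact this.le
  have hv := fun k => (hsob k).isWeakGradient_weakGradient
  have hvm : ∀ k, AEStronglyMeasurable (weakGradient (u (ψ k))) volume := fun k =>
    (hv k).locallyIntegrable_grad.aestronglyMeasurable
  have hC : (‖α⁻¹‖ₑ * s) ^ γ⁻¹ * (1 + (volume : Measure Ω) univ) ^ (1 / 2 : ℝ) ≠ ⊤ := by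
    refine ENNReal.mul_ne_top (ENNReal.rpow_ne_top_of_nonneg (inv_pos.2 hγ).le
      (ENNReal.mul_ne_top enorm_ne_top hs_top)) (ENNReal.rpow_ne_top_of_nonneg (by norm_num)
      (ENNReal.add_ne_top.2 ⟨ENNReal.one_ne_top, measure_ne_top _ _⟩))
  obtain ⟨m, hm, hmi, hmt⟩ := exists_isWeakGradient_le_of_ae_eventually_le hf hf1 hf2
    (fun k => hu (ψ k)) hu₀ (h.comp hψ.tendsto_atTop) hv hC
    (fun k => eLpNorm_two_le_of_growth hα hγ hgrow (hvm k) (zero_le_one.trans (hp1 _))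
      ((div_le_iff₀ hγ).1 (hψP k).2.2) (hen k))
    (ae_eventually_le_of_eLpNorm_le (fun k => hf.aemeasurable_comp (hu (ψ k)) (hvm k))
      (fun k => hp1 _) (fun k => (hψP k).2.1) hst ht_top hen)
  calc _ ≤ ENNReal.ofReal t.toReal := supremalFunctional_le_of_isWeakGradient hΩ hu₀ hm hmi hmt
    _ = t := ENNReal.ofReal_toReal ht_top
    _ ≤ r := htr.le

/-- Finiteness of the supremal energy puts `u` in `W^{1,∞}`, hence in `W^{1,p}`. Growth makes the
integrand nonnegative, so its absolute value is bounded by the essential supremum. -/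
theorem powerFunctional_le [IsFiniteMeasure (volume : Measure Ω)] (hf2 : HasLowerGrowth f)
    {p : ℝ} (hp : 1 ≤ p) (u : Ω → EuclideanSpace ℝ (Fin d)) (hF : supremalFunctional f u ≠ ⊤) :
    powerFunctional f p u ≤ (volume : Measure Ω) univ ^ p⁻¹ * supremalFunctional f u := by
  have hsob : MemSobolev ∞ u := by
    by_contra hcon
    exact hF (by rw [supremalFunctional, if_neg hcon])
  have hsobp : MemSobolev (ENNReal.ofReal p) u := by
    obtain ⟨h1, v, hv, h2⟩ := hsob
    exact ⟨h1.mono_exponent le_top, v, hv, h2.mono_exponent le_top⟩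
  obtain ⟨α, γ, hα, hγ, hgrow⟩ := hf2
  rw [supremalFunctional, if_pos hsob] at hF ⊢
  rw [powerFunctional, if_pos hsobp]
  set S := essSup (fun x => ENNReal.ofReal (f x (u x) (weakGradient u x))) (volume : Measure Ω)
  have hle : ∀ᵐ x : Ω, ‖f x (u x) (weakGradient u x)‖ ≤ S.toReal := by
    filter_upwards [hgrow, ENNReal.ae_le_essSup
      (fun x => ENNReal.ofReal (f x (u x) (weakGradient u x)))] with x hx hxS
    have h0 : 0 ≤ f x (u x) (weakGradient u x) :=
      le_trans (by positivity) (hx (u x) (weakGradient u x))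
    rw [Real.norm_of_nonneg h0]
    exact (ENNReal.ofReal_le_iff_le_toReal hF).1 hxS
  have := eLpNorm_le_of_ae_bound (p := ENNReal.ofReal p) hle
  rwa [ENNReal.toReal_ofReal (zero_le_one.trans hp), ENNReal.ofReal_toReal hF] at this

/-- The constant sequence is a recovery sequence. -/
theorem tendsto_powerFunctional (hΩ : IsOpen Ω) [IsFiniteMeasure (volume : Measure Ω)]
    (hf : IsNormalIntegrand f) (hf1 : IsLevelConvexInGradient f) (hf2 : HasLowerGrowth f)
    {u : Ω → EuclideanSpace ℝ (Fin d)} (hu : MemLp u ∞ volume)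
    {p : ℕ → ℝ} (hp1 : ∀ n, 1 ≤ p n) (hp : Tendsto p atTop atTop) :
    Tendsto (fun n => powerFunctional f (p n) u) atTop (𝓝 (supremalFunctional f u)) := by
  have hlow := supremalFunctional_le_liminf_powerFunctional hΩ hf hf1 hf2 (u := fun _ => u)
    (fun _ => hu.aestronglyMeasurable) hu (by simp) hp1 hp
  refine tendsto_of_le_liminf_of_limsup_le hlow ?_
  by_cases hF : supremalFunctional f u = ⊤
  · rw [hF]
    exact le_top
  -- The added `1` keeps the base positive, so its power tends to `1` even when `|Ω| = 0`.
  have hup : ∀ n, powerFunctional f (p n) u ≤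
      (1 + (volume : Measure Ω) univ) ^ (p n)⁻¹ * supremalFunctional f u := fun n =>
    (powerFunctional_le hf2 (hp1 n) u hF).trans (by
      gcongr
      · exact inv_nonneg.2 (zero_le_one.trans (hp1 n))
      · exact le_add_self)
  have hlim : Tendsto (fun n => (1 + (volume : Measure Ω) univ) ^ (p n)⁻¹ *
      supremalFunctional f u) atTop (𝓝 (supremalFunctional f u)) := by
    have h1 : Tendsto (fun n => (1 + (volume : Measure Ω) univ) ^ (p n)⁻¹) atTop (𝓝 1) := by
      have hM : 1 + (volume : Measure Ω) univ ≠ ⊤ :=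
        ENNReal.add_ne_top.2 ⟨ENNReal.one_ne_top, measure_ne_top _ _⟩
      have hM0 : 0 < (1 + (volume : Measure Ω) univ).toReal := ENNReal.toReal_pos (by simp) hM
      have := ENNReal.tendsto_ofReal
        (((Real.continuous_const_rpow hM0.ne').tendsto 0).comp (tendsto_inv_atTop_zero.comp hp))
      rw [Real.rpow_zero, ENNReal.ofReal_one] at this
      refine this.congr fun n => ?_
      simp only [Function.comp_apply]
      rw [← ENNReal.ofReal_rpow_of_pos hM0, ENNReal.ofReal_toReal hM]
    simpa using ENNReal.Tendsto.mul_const h1 (Or.inr hF)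
  exact (limsup_le_limsup (Eventually.of_forall hup)).trans hlim.limsup_eq.le

/-- Treats both choices of `X` at once: all that matters is that elements are essentially bounded
and that the metric controls the `L^∞` distance. -/
theorem gammaConvergesAtTop_powerFunctional (hΩ : IsOpen Ω)
    [IsFiniteMeasure (volume : Measure Ω)]
    (hf : IsNormalIntegrand f) (hf1 : IsLevelConvexInGradient f) (hf2 : HasLowerGrowth f)
    {X : Type*} [MetricSpace X] (coe : X → Ω → EuclideanSpace ℝ (Fin d))
    (hmem : ∀ u, MemLp (coe u) ∞ volume)
    (hdist : ∀ u w, eLpNorm (coe u - coe w) ∞ volume ≤ edist u w) :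
    GammaConvergesAtTop (fun p u => powerFunctional f p (coe u))
      (fun u => supremalFunctional f (coe u)) := by
  intro p hp1 hp
  refine ⟨fun x y hxy => ?_, fun x => ⟨fun _ => x, tendsto_const_nhds, ?_⟩⟩
  · refine supremalFunctional_le_liminf_powerFunctional hΩ hf hf1 hf2
      (fun k => (hmem (y k)).aestronglyMeasurable) (hmem x) ?_ hp1 hp
    exact tendsto_of_tendsto_of_tendsto_of_le_of_le tendsto_const_nhds
      (tendsto_iff_edist_tendsto_0.1 hxy) (fun _ => zero_le) fun k => hdist _ _
  · exact tendsto_powerFunctional hΩ hf hf1 hf2 (hmem x) hp1 hp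

end GammaLimit

theorem mainTheorem5 (N d : ℕ) (hN : 1 ≤ N) (hd : 1 ≤ d)
    (Ω : Set (EuclideanSpace ℝ (Fin N))) (hΩ : IsOpen Ω) (hΩb : Bornology.IsBounded Ω)
    (f : Ω → EuclideanSpace ℝ (Fin d) → GradSpace N d → ℝ)
    (hf : IsNormalIntegrand f) (hf1 : IsLevelConvexInGradient f) (hf2 : HasLowerGrowth f) :
    GammaConvergesAtTop (X := Lp (EuclideanSpace ℝ (Fin d)) ∞ (volume : Measure Ω))
      (fun p u => powerFunctional f p u) (fun u => supremalFunctional f u) ∧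
    GammaConvergesAtTop (X := Ω →ᵇ EuclideanSpace ℝ (Fin d))
      (fun p u => powerFunctional f p u) (fun u => supremalFunctional f u) := by
  have := isFiniteMeasure_volume_subtype hΩ hΩb
  constructor
  · refine gammaConvergesAtTop_powerFunctional hΩ hf hf1 hf2
      (fun u : Lp (EuclideanSpace ℝ (Fin d)) ∞ (volume : Measure Ω) => u) (fun u => Lp.memLp u)
      fun u w => ?_
    rw [Lp.edist_def]
  · refine gammaConvergesAtTop_powerFunctional hΩ hf hf1 hf2
      (fun (u : Ω →ᵇ EuclideanSpace ℝ (Fin d)) => (u : Ω → EuclideanSpace ℝ (Fin d)))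
      (fun u => MemLp.of_bound u.continuous.aestronglyMeasurable ‖u‖
        (ae_of_all _ u.norm_coe_le_norm)) fun u w => ?_
    rw [edist_dist, eLpNorm_exponent_top]
    refine eLpNormEssSup_le_of_ae_bound (ae_of_all _ fun x => ?_)
    rw [Pi.sub_apply, ← dist_eq_norm]
    exact BoundedContinuousFunction.dist_coe_le_dist x
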